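/- **Colored Tverberg theorem.** Let $C\subset\mathbb{R}^d$ be a finite set partitioned into $d+1$ color classes $C_1,\dots,C_{d+1}$. A subset $R\subseteq C$ is called *rainbow* if $|R\cap C_j|\le 1$ for every $j$. For every $d\ge 1$ and $r\ge 2$ there exists $t$ with the following property: $(*)$ whenever $C\subset\mathbb{R}^d$ is a set of $(d+1)t$ points partitioned into $t$-point color classes $C_1,\dots,C_{d+1}$, there are pairwise disjoint rainbow subsets $R_1,\dots,R_r\subseteq C$ whose convex hulls have a common point, i.e. $\bigcap_{i=1}^r\operatorname{conv}(R_i)\neq\emptyset$. Moreover, if $t(d,r)$ denotes the smallest $t$ for which $(*)$ holds, then $t(d,r)=r$ whenever $r+1$ is a prime number. -/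

import Mathlib

/-- Given color classes `C j`, a set `R` of points of `⋃ j, C j` is rainbow if it contains at most
one point of each color. -/
def IsRainbow {E κ : Type*} (C : κ → Set E) (R : Set E) : Prop :=
  R ⊆ ⋃ j, C j ∧ ∀ j, (R ∩ C j).encard ≤ 1

/-- A rainbow `r`-partition: an ordered `r`-tuple of pairwise disjoint rainbow subsets
(not required to cover all the points). -/
def IsRainbowPartition {E κ : Type*} (C : κ → Set E) {r : ℕ} (R : Fin r → Set E) : Prop :=
  (∀ i, IsRainbow C (R i)) ∧ Pairwise fun i j => Disjoint (R i) (R j)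

/-- The tuple `R` is Tverberg if the convex hulls of its members have a common point. -/
def IsTverberg {d r : ℕ} (R : Fin r → Set (EuclideanSpace ℝ (Fin d))) : Prop :=
  ∃ x, ∀ i, x ∈ convexHull ℝ (R i)

/-- The conclusion of the colored Tverberg theorem for `d`, `r` and class size `t`: whenever a set
of `(d + 1) t` points of `ℝ ^ d` is partitioned into `t`-point color classes
`C 0, …, C d`, it has a Tverberg rainbow `r`-partition. -/
def ColoredTverbergProperty (d r t : ℕ) : Prop :=
  ∀ C : Fin (d + 1) → Set (EuclideanSpace ℝ (Fin d)),
    (∀ j, (C j).encard = t) → (Pairwise fun i j => Disjoint (C i) (C j)) →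
      ∃ R : Fin r → Set (EuclideanSpace ℝ (Fin d)), IsRainbowPartition C R ∧ IsTverberg R

/-! Let `w 0, …, w r` be the classes of the basis vectors in `W = ℝ^(r+1)/(1,…,1)`, and let `r + 1`
be prime. Give the points labels in `Fin (r + 1)`, injectively on each class, so that each class
leaves one label unused. Represent a point with barycentric vector `x` and label `i` by `x ⊗ w i` in
`ℝ^(d+1) ⊗ W`, and add the vector `z = (1,…,1) ⊗ w (last r)`, which is the constant `-1` in
coordinates. If `0` is a convex combination of `z` and these vectors, all label parts have the same
weighted sum, with `z` counted in the last part. Dropping the last part leaves `r` rainbow sets with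
a common point in their hulls (`exists_mem_convexHull_of_mem_coneSet`).

Such a labelling exists by a degree argument (`exists_labelling`). Labellings are the facets of a
join of `d + 1` chessboard complexes, and `chessboardDegree` counts with sign the facets whose cone
contains `-z`. When one vector moves, contributions cancel across common ridges, except for a sum
invariant under the free cyclic action on labels. The degree is therefore constant modulo `r + 1`
(`chessboardDegree_update_modEq`, resting on `coneIndex_cocycle`). One explicit configuration has
degree `(r!)^(d+1)`, which the prime `r + 1` does not divide. Generic configurations thus have
nonzero degree, and a closedness argument covers all others.

For arbitrary `r`, a larger prime is used and superfluous parts are discarded. The lower bound comes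
from classes clustered at the vertices of a simplex (`ColoredTverbergProperty.le`). -/

open Finset Function

/-! ### Counting the crossings of a line with the boundary of an orthant -/

/-- On a line `x ↦ (b ↦ (x - l b) * s b)` the signed number of facets of the open negative orthant crossed
at positive parameters accounts for the difference between its two ends. -/
lemma sum_sign_crossings {ι : Type*} [Fintype ι] [DecidableEq ι] (s l : ι → ℝ)
    (hs : ∀ b, s b ≠ 0) (hl0 : ∀ b, l b ≠ 0) (hl : Injective l) :
    (if ∀ b, 0 < l b * s b then (1 : ℤ) else 0) -
      ∑ b, (if 0 < l b ∧ ∀ b', b' ≠ b → (l b - l b') * s b' < 0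
        then ((SignType.sign (s b) : SignType) : ℤ) else 0) =
      if ∀ b, s b < 0 then 1 else 0 := by
  classical
  -- Crossing facet `b` is an exit from the orthant when `s b > 0` and an entrance when `s b < 0`.
  -- The weak inequalities only absorb the case `b' = b`.
  have key : ∀ b, (if 0 < l b ∧ ∀ b', b' ≠ b → (l b - l b') * s b' < 0
        then ((SignType.sign (s b) : SignType) : ℤ) else 0) =
      (if 0 < s b ∧ 0 < l b ∧ (∀ b', s b' < 0 → l b' < l b) ∧ (∀ b', 0 < s b' → l b ≤ l b')
        then 1 else 0) -
      (if s b < 0 ∧ 0 < l b ∧ (∀ b', s b' < 0 → l b' ≤ l b) ∧ (∀ b', 0 < s b' → l b < l b')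
        then 1 else 0) := by
    intro b
    have e1 : (∀ b', b' ≠ b → (l b - l b') * s b' < 0) ↔
        ∀ b', b' ≠ b → (s b' < 0 → l b' < l b) ∧ (0 < s b' → l b < l b') := by
      refine forall_congr' fun b' => forall_congr' fun hb => ?_
      rcases lt_or_gt_of_ne (hs b') with h | h
      · simp [h, h.not_gt, mul_neg_iff]
      · simp [h, h.not_gt, mul_neg_iff]
    rw [if_congr (and_congr_right' e1) rfl rfl]
    have hne : ∀ b', b' ≠ b → l b' ≠ l b := fun b' h h' => h (hl h')
    rcases lt_or_gt_of_ne (hs b) with h | h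
    · rw [if_neg (fun H => H.1.not_gt h : ¬ (0 < s b ∧ _)), sign_neg h]
      have : (0 < l b ∧ ∀ b', b' ≠ b → (s b' < 0 → l b' < l b) ∧ (0 < s b' → l b < l b')) ↔
        (s b < 0 ∧ 0 < l b ∧ (∀ b', s b' < 0 → l b' ≤ l b) ∧
          (∀ b', 0 < s b' → l b < l b')) := by
        constructor
        · rintro ⟨h1, h2⟩
          refine ⟨h, h1, fun b' hb' => ?_, fun b' hb' => ?_⟩
          · by_cases e : b' = b
            · rw [e]
            · exact ((h2 b' e).1 hb').le
          · exact (h2 b' (by rintro rfl; exact h.not_gt hb')).2 hb'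
        · rintro ⟨-, h1, h2, h3⟩
          exact ⟨h1, fun b' e => ⟨fun hb' => lt_of_le_of_ne (h2 b' hb') (hne b' e), h3 b'⟩⟩
      rw [if_congr this rfl rfl]
      split_ifs <;> simp
    · rw [if_neg (fun H => H.1.not_gt h : ¬ (s b < 0 ∧ _)), sign_pos h]
      have : (0 < l b ∧ ∀ b', b' ≠ b → (s b' < 0 → l b' < l b) ∧ (0 < s b' → l b < l b')) ↔
        (0 < s b ∧ 0 < l b ∧ (∀ b', s b' < 0 → l b' < l b) ∧
          (∀ b', 0 < s b' → l b ≤ l b')) := by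
        constructor
        · rintro ⟨h1, h2⟩
          refine ⟨h, h1, fun b' hb' => ?_, fun b' hb' => ?_⟩
          · exact (h2 b' (by rintro rfl; exact h.not_gt hb')).1 hb'
          · by_cases e : b' = b
            · rw [e]
            · exact ((h2 b' e).2 hb').le
        · rintro ⟨-, h1, h2, h3⟩
          exact ⟨h1, fun b' e => ⟨h2 b', fun hb' => lt_of_le_of_ne (h3 b' hb') (hne b' e).symm⟩⟩
      rw [if_congr this rfl rfl]
      split_ifs <;> simp
  -- The orthant is convex, so the line enters it at most once and leaves it at most once; each sum
  -- of indicators is itself an indicator.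
  have single : ∀ (P : ι → Prop) [DecidablePred P], (∀ b b', P b → P b' → b = b') →
      (∑ b, if P b then (1 : ℤ) else 0) = if ∃ b, P b then 1 else 0 := by
    intro P _ hP
    split_ifs with h
    · obtain ⟨b, hb⟩ := h
      rw [Finset.sum_eq_single b]
      · simp [hb]
      · intro b' _ hne
        exact if_neg fun hb' => hne (hP _ _ hb' hb)
      · simp
    · push Not at h
      simp [h]
  rw [Finset.sum_congr rfl fun b _ => key b, Finset.sum_sub_distrib, single, single]
  rotate_left
  · rintro b b' ⟨h1, h2, h3, h4⟩ ⟨h1', h2', h3', h4'⟩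
    exact hl (le_antisymm (h3' b h1) (h3 b' h1'))
  · rintro b b' ⟨h1, h2, h3, h4⟩ ⟨h1', h2', h3', h4'⟩
    exact hl (le_antisymm (h4 b' h1') (h4' b h1))
  have hmin : (∃ q, 0 < s q) → ∃ q, 0 < s q ∧ ∀ b', 0 < s b' → l q ≤ l b' := by
    rintro ⟨q, hq⟩
    obtain ⟨m, hm, hm'⟩ := (univ.filter fun b => 0 < s b).exists_min_image l ⟨q, by simpa⟩
    exact ⟨m, by simpa using hm, fun b' hb' => hm' b' (by simpa)⟩
  have hmax : (∃ q, s q < 0) → ∃ q, s q < 0 ∧ ∀ b', s b' < 0 → l b' ≤ l q := by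
    rintro ⟨q, hq⟩
    obtain ⟨m, hm, hm'⟩ := (univ.filter fun b => s b < 0).exists_max_image l ⟨q, by simpa⟩
    exact ⟨m, by simpa using hm, fun b' hb' => hm' b' (by simpa)⟩
  have hpos : ∀ b, 0 < l b * s b ↔ (s b < 0 → l b < 0) ∧ (0 < s b → 0 < l b) := by
    intro b
    rcases lt_or_gt_of_ne (hs b) with h | h <;> simp [h, h.not_gt, mul_pos_iff]
  simp only [hpos]
  by_cases hQ : ∃ q, 0 < s q
  · obtain ⟨q, hq, hq'⟩ := hmin hQ
    rw [if_neg (fun H : ∀ b, s b < 0 => (H q).not_gt hq)]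
    by_cases hP : ∃ m, s m < 0
    · obtain ⟨m, hm, hm'⟩ := hmax hP
      have A1 : (∀ b, (s b < 0 → l b < 0) ∧ (0 < s b → 0 < l b)) ↔ l m < 0 ∧ 0 < l q :=
        ⟨fun H => ⟨(H m).1 hm, (H q).2 hq⟩, fun H b =>
          ⟨fun h => (hm' b h).trans_lt H.1, fun h => H.2.trans_le (hq' b h)⟩⟩
      have A2 : (∃ b, 0 < s b ∧ 0 < l b ∧ (∀ b', s b' < 0 → l b' < l b) ∧
          (∀ b', 0 < s b' → l b ≤ l b')) ↔ 0 < l q ∧ l m < l q := by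
        constructor
        · rintro ⟨b, h1, h2, h3, h4⟩
          have : l b = l q := le_antisymm (h4 q hq) (hq' b h1)
          exact ⟨this ▸ h2, this ▸ h3 m hm⟩
        · rintro ⟨h1, h2⟩
          exact ⟨q, hq, h1, fun b' hb' => (hm' b' hb').trans_lt h2, hq'⟩
      have A3 : (∃ b, s b < 0 ∧ 0 < l b ∧ (∀ b', s b' < 0 → l b' ≤ l b) ∧
          (∀ b', 0 < s b' → l b < l b')) ↔ 0 < l m ∧ l m < l q := by
        constructor
        · rintro ⟨b, h1, h2, h3, h4⟩
          have : l b = l m := le_antisymm (hm' b h1) (h3 m hm)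
          exact ⟨this ▸ h2, this ▸ h4 q hq⟩
        · rintro ⟨h1, h2⟩
          exact ⟨m, hm, h1, hm', fun b' hb' => h2.trans_le (hq' b' hb')⟩
      rw [if_congr A1 rfl rfl, if_congr A2 rfl rfl, if_congr A3 rfl rfl]
      rcases lt_or_gt_of_ne (hl0 m) with h | h <;> split_ifs <;> first | rfl | (exfalso; grind)
    · push Not at hP
      have A1 : (∀ b, (s b < 0 → l b < 0) ∧ (0 < s b → 0 < l b)) ↔ 0 < l q :=
        ⟨fun H => (H q).2 hq, fun H b =>
          ⟨fun h => absurd h (hP b).not_gt, fun h => H.trans_le (hq' b h)⟩⟩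
      have A2 : (∃ b, 0 < s b ∧ 0 < l b ∧ (∀ b', s b' < 0 → l b' < l b) ∧
          (∀ b', 0 < s b' → l b ≤ l b')) ↔ 0 < l q := by
        constructor
        · rintro ⟨b, h1, h2, h3, h4⟩
          exact h2.trans_le (h4 q hq)
        · exact fun h1 => ⟨q, hq, h1, fun b' hb' => absurd hb' (hP b').not_gt, hq'⟩
      have A3 : ¬ (∃ b, s b < 0 ∧ 0 < l b ∧ (∀ b', s b' < 0 → l b' ≤ l b) ∧
          (∀ b', 0 < s b' → l b < l b')) := fun ⟨b, h1, _⟩ => (hP b).not_gt h1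
      rw [if_congr A1 rfl rfl, if_congr A2 rfl rfl, if_neg A3]
      simp
  · push Not at hQ
    have hneg : ∀ b, s b < 0 := fun b => lt_of_le_of_ne (hQ b) (hs b)
    rw [if_pos hneg]
    have A2 : ¬ (∃ b, 0 < s b ∧ 0 < l b ∧ (∀ b', s b' < 0 → l b' < l b) ∧
          (∀ b', 0 < s b' → l b ≤ l b')) := fun ⟨b, h1, _⟩ => (hQ b).not_gt h1
    rw [if_neg A2]
    by_cases hN : Nonempty ι
    · obtain ⟨m, hm, hm'⟩ := hmax ⟨hN.some, hneg _⟩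
      have A1 : (∀ b, (s b < 0 → l b < 0) ∧ (0 < s b → 0 < l b)) ↔ l m < 0 :=
        ⟨fun H => (H m).1 hm, fun H b =>
          ⟨fun h => (hm' b h).trans_lt H, fun h => absurd h (hQ b).not_gt⟩⟩
      have A3 : (∃ b, s b < 0 ∧ 0 < l b ∧ (∀ b', s b' < 0 → l b' ≤ l b) ∧
          (∀ b', 0 < s b' → l b < l b')) ↔ 0 < l m := by
        constructor
        · rintro ⟨b, h1, h2, h3, h4⟩
          exact h2.trans_le (hm' b h1)
        · exact fun h1 => ⟨m, hm, h1, hm', fun b' hb' => absurd hb' (hQ b').not_gt⟩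
      rw [if_congr A1 rfl rfl, if_congr A3 rfl rfl]
      rcases lt_or_gt_of_ne (hl0 m) with h | h <;> simp [h, h.not_gt]
    · rw [not_nonempty_iff] at hN
      simp

/-! ### The signed cone index and its cocycle identity -/

/-- The determinant of a family of vectors, viewed as the rows of a matrix. -/
noncomputable def rowDet {ι : Type*} [Fintype ι] [DecidableEq ι] (F : ι → ι → ℝ) : ℝ :=
  (Matrix.of F).det

/-- The sign of `F` if `-z` lies in the interior of the simplicial cone spanned by `F`, else `0`. -/
noncomputable def coneIndex {ι : Type*} [Fintype ι] [DecidableEq ι] (F : ι → ι → ℝ)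
    (z : ι → ℝ) : ℤ :=
  open Classical in
  if ∀ b, rowDet F * rowDet (update F b z) < 0 then
    ((SignType.sign (rowDet F) : SignType) : ℤ) else 0

section coneIndex

variable {ι : Type*} [Fintype ι] [DecidableEq ι]

lemma rowDet_update_sum (F : ι → ι → ℝ) (b : ι) (c : ι → ℝ) :
    rowDet (update F b (∑ k, c k • F k)) = c b * rowDet F := by
  exact Matrix.det_updateRow_sum (Matrix.of F) b c

lemma rowDet_ne_zero_iff (F : ι → ι → ℝ) : rowDet F ≠ 0 ↔ LinearIndependent ℝ F := by
  rw [rowDet, ← isUnit_iff_ne_zero, ← Matrix.isUnit_iff_isUnit_det,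
    ← Matrix.linearIndependent_rows_iff_isUnit]
  rfl

lemma exists_eq_sum_of_rowDet_ne_zero {F : ι → ι → ℝ} (hF : rowDet F ≠ 0) (z : ι → ℝ) :
    ∃ t : ι → ℝ, z = ∑ b, t b • F b := by
  have hu : IsUnit (Matrix.of F) := (Matrix.isUnit_iff_isUnit_det _).2 (isUnit_iff_ne_zero.2 hF)
  obtain ⟨t, ht⟩ := (Matrix.vecMul_surjective_iff_isUnit.2 hu) z
  refine ⟨t, ?_⟩
  rw [← ht]
  ext i
  simp [Matrix.vecMul, dotProduct]

open Classical in
lemma coneIndex_eq {F : ι → ι → ℝ} (hF : rowDet F ≠ 0) {z t : ι → ℝ}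
    (hz : z = ∑ b, t b • F b) :
    coneIndex F z =
      if ∀ b, t b < 0 then ((SignType.sign (rowDet F) : SignType) : ℤ) else 0 := by
  have : (∀ b, rowDet F * rowDet (update F b z) < 0) ↔ ∀ b, t b < 0 := by
    refine forall_congr' fun b => ?_
    rw [hz, rowDet_update_sum, mul_left_comm, ← sq]
    have : 0 < rowDet F ^ 2 := by positivity
    exact ⟨fun h => by nlinarith, fun h => mul_neg_of_neg_of_pos h this⟩
  rw [coneIndex, if_congr this rfl rfl]

lemma exists_of_coneIndex_ne_zero {F : ι → ι → ℝ} {z : ι → ℝ} (h : coneIndex F z ≠ 0) :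
    rowDet F ≠ 0 ∧ ∃ t : ι → ℝ, (∀ b, t b < 0) ∧ z = ∑ b, t b • F b := by
  classical
  have hF : rowDet F ≠ 0 := by
    rintro h0
    apply h
    simp [coneIndex, h0]
  obtain ⟨t, ht⟩ := exists_eq_sum_of_rowDet_ne_zero hF z
  rw [coneIndex_eq hF ht] at h
  exact ⟨hF, t, by by_contra h'; exact h (if_neg h'), ht⟩

/-- The cone index is a cocycle on families in general position. -/
theorem coneIndex_cocycle {F : ι → ι → ℝ} {u z : ι → ℝ} (hF : rowDet F ≠ 0)
    (hu : ∀ b, rowDet (update F b u) ≠ 0) (hz : ∀ b, rowDet (update F b z) ≠ 0)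
    (huz : ∀ b b', b' ≠ b → rowDet (update (update F b u) b' z) ≠ 0) :
    coneIndex F z - ∑ b, coneIndex (update F b u) z = coneIndex F u := by
  classical
  -- The families `F` and `update F b u` are the facets of the simplex on the `F b` and `u`. The
  -- signed number of facets hit by the ray through `-z` is the degree of its boundary around `0`,
  -- nonzero exactly when `-u` is interior to the cone of `F`.
  obtain ⟨s, hs⟩ := exists_eq_sum_of_rowDet_ne_zero hF u
  obtain ⟨t, ht⟩ := exists_eq_sum_of_rowDet_ne_zero hF z
  have hub : ∀ b, rowDet (update F b u) = s b * rowDet F := fun b => by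
    rw [hs, rowDet_update_sum]
  have hzb : ∀ b, rowDet (update F b z) = t b * rowDet F := fun b => by
    rw [ht, rowDet_update_sum]
  have hs0 : ∀ b, s b ≠ 0 := fun b h => hu b (by rw [hub, h, zero_mul])
  have ht0 : ∀ b, t b ≠ 0 := fun b h => hz b (by rw [hzb, h, zero_mul])
  -- In the basis `F` the line `z + x • u` has coordinates `(x - l b) * s b`, so `l b` is the
  -- parameter at which coordinate `b` vanishes. Solving for `z` at that parameter gives its
  -- coordinates `c b` in the basis `update F b u`.
  let l : ι → ℝ := fun b => -t b / s b
  have htl : ∀ b, t b = -(l b * s b) := fun b => by simp only [l]; field_simp [hs0 b]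
  let c : ι → ι → ℝ := fun b b' => if b' = b then -l b else (l b - l b') * s b'
  have hzc : ∀ b, z = ∑ k, c b k • (update F b u) k := by
    intro b
    have h1 : ∑ k, c b k • (update F b u) k =
        (-l b) • u + ∑ k ∈ univ.erase b, ((l b - l k) * s k) • F k := by
      rw [← Finset.add_sum_erase univ _ (mem_univ b)]
      congr 1
      · simp [c]
      · refine Finset.sum_congr rfl fun k hk => ?_
        rw [update_of_ne (ne_of_mem_erase hk)]
        simp [c, ne_of_mem_erase hk]
    have h2 : ∑ k ∈ univ.erase b, ((l b - l k) * s k) • F k =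
        ∑ k, ((l b - l k) * s k) • F k := by
      rw [← Finset.add_sum_erase univ (fun k => ((l b - l k) * s k) • F k) (mem_univ b)]
      simp
    rw [h1, h2, hs, ht, Finset.smul_sum, ← Finset.sum_add_distrib]
    refine Finset.sum_congr rfl fun k _ => ?_
    rw [smul_smul, ← add_smul, htl k]
    congr 1
    ring
  have hl0 : ∀ b, l b ≠ 0 := fun b h => ht0 b (by rw [htl, h]; simp)
  -- Two coordinates vanishing at the same parameter would make the coefficient `c b b'` zero,
  -- against `huz`.
  have hinj : Injective l := by
    intro b b' h
    by_contra hne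
    apply huz b b' (Ne.symm hne)
    rw [hzc b, rowDet_update_sum]
    simp [c, Ne.symm hne, h]
  rw [coneIndex_eq hF ht, coneIndex_eq hF hs]
  have hterm : ∀ b, coneIndex (update F b u) z =
      (if 0 < l b ∧ ∀ b', b' ≠ b → (l b - l b') * s b' < 0
        then ((SignType.sign (s b) : SignType) : ℤ) else 0) *
        ((SignType.sign (rowDet F) : SignType) : ℤ) := by
    intro b
    rw [coneIndex_eq (hu b) (hzc b), ite_mul, zero_mul, hub, sign_mul]
    have : (∀ b', c b b' < 0) ↔ 0 < l b ∧ ∀ b', b' ≠ b → (l b - l b') * s b' < 0 := by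
      constructor
      · intro h
        refine ⟨by simpa [c] using h b, fun b' hb' => by simpa [c, hb'] using h b'⟩
      · rintro ⟨h1, h2⟩ b'
        by_cases e : b' = b
        · simpa [c, e] using h1
        · simpa [c, e] using h2 b' e
    rw [if_congr this rfl rfl]
    push_cast
    rfl
  have ht' : (∀ b, t b < 0) ↔ ∀ b, 0 < l b * s b := forall_congr' fun b => by simp [htl b]
  rw [Finset.sum_congr rfl fun b _ => hterm b, ← Finset.sum_mul, if_congr ht' rfl rfl]
  have := sum_sign_crossings s l hs0 hl0 hinj
  have e : ∀ (P : Prop) [Decidable P] (x : ℤ), (if P then x else 0) = (if P then 1 else 0) * x := by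
    intros; split_ifs <;> simp
  rw [e _ _, e (∀ b, s b < 0), ← this]
  ring

lemma rowDet_map (A : (ι → ℝ) →ₗ[ℝ] (ι → ℝ)) (F : ι → ι → ℝ) :
    rowDet (fun b => A (F b)) = rowDet F * LinearMap.det A := by
  rw [← LinearMap.det_toMatrix', ← Matrix.det_transpose (LinearMap.toMatrix' A), rowDet, rowDet,
    ← Matrix.det_mul]
  congr 1
  ext b i
  have := congrFun (LinearMap.toMatrix'_mulVec A (F b)) i
  simp only [Matrix.of_apply, Matrix.mul_apply, Matrix.transpose_apply]
  rw [← this]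
  simp [Matrix.mulVec, dotProduct, mul_comm]

lemma coneIndex_map {A : (ι → ℝ) →ₗ[ℝ] (ι → ℝ)} (hA : LinearMap.det A = 1) (F : ι → ι → ℝ)
    (z : ι → ℝ) : coneIndex (fun b => A (F b)) (A z) = coneIndex F z := by
  have : ∀ b, update (fun b => A (F b)) b (A z) = fun b' => A (update F b z b') := by
    intro b
    ext1 b'
    by_cases h : b' = b
    · subst h; simp
    · simp [h]
  simp only [coneIndex, this, rowDet_map, hA, mul_one]

end coneIndex

/-! ### The chessboard degree and its invariance modulo `r + 1` -/

section chessboard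

variable {κ : Type*} {r : ℕ}

/-- Extend each row of `f` by a zero at the last label. -/
def extendZero (f : κ × Fin r → ℝ) (j : κ) (i : Fin (r + 1)) : ℝ :=
  Fin.snoc (α := fun _ => ℝ) (fun a => f (j, a)) 0 i

@[simp] lemma extendZero_castSucc (f : κ × Fin r → ℝ) (j : κ) (a : Fin r) :
    extendZero f j a.castSucc = f (j, a) := by
  simp [extendZero]

@[simp] lemma extendZero_last (f : κ × Fin r → ℝ) (j : κ) :
    extendZero f j (Fin.last r) = 0 := by
  simp [extendZero]

/-- The action of the cyclic group of labels on `κ → ℝ ^ (r + 1) / (1, …, 1)`, in the coordinates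
of `κ × Fin r → ℝ` given by representatives vanishing at the last label. -/
def labelShift (κ : Type*) {r : ℕ} (i : Fin (r + 1)) : (κ × Fin r → ℝ) →ₗ[ℝ] (κ × Fin r → ℝ) where
  toFun f := fun b => extendZero f b.1 (b.2.castSucc - i) - extendZero f b.1 (Fin.last r - i)
  map_add' f g := by
    have h : ∀ j i, extendZero (f + g) j i = extendZero f j i + extendZero g j i := by
      intro j i
      induction i using Fin.lastCases <;> simp
    ext b
    simp only [h, Pi.add_apply]
    ring
  map_smul' c f := by
    have h : ∀ j i, extendZero (c • f) j i = c * extendZero f j i := by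
      intro j i
      induction i using Fin.lastCases <;> simp
    ext b
    simp only [h, Pi.smul_apply, smul_eq_mul, RingHom.id_apply]
    ring

lemma labelShift_apply (i : Fin (r + 1)) (f : κ × Fin r → ℝ) (b : κ × Fin r) :
    labelShift κ i f b =
      extendZero f b.1 (b.2.castSucc - i) - extendZero f b.1 (Fin.last r - i) := rfl

lemma extendZero_labelShift (i k : Fin (r + 1)) (f : κ × Fin r → ℝ) (j : κ) :
    extendZero (labelShift κ i f) j k =
      extendZero f j (k - i) - extendZero f j (Fin.last r - i) := by
  induction k using Fin.lastCases <;> simp [labelShift_apply]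

lemma labelShift_add (i k : Fin (r + 1)) (f : κ × Fin r → ℝ) :
    labelShift κ (i + k) f = labelShift κ i (labelShift κ k f) := by
  ext b
  rw [labelShift_apply, labelShift_apply, extendZero_labelShift, extendZero_labelShift,
    sub_add_eq_sub_sub, sub_add_eq_sub_sub]
  ring

lemma labelShift_zero (f : κ × Fin r → ℝ) : labelShift κ 0 f = f := by
  ext b
  simp [labelShift_apply]

/-- Doubling is invertible in a cyclic group of odd order. Each shift is thereby a square, hence an
even permutation. -/
lemma exists_add_self_eq (hr : Odd (r + 1)) (k : Fin (r + 1)) : ∃ h : Fin (r + 1), h + h = k := by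
  obtain ⟨m, hm⟩ := hr
  refine ⟨(m + 1) • k, ?_⟩
  have h1 : (r + 1) • k = 0 := by
    have := card_nsmul_eq_zero (x := k)
    simpa using this
  rw [← add_nsmul, show m + 1 + (m + 1) = (r + 1) + 1 by omega, add_nsmul, h1]
  simp

/-- The determinant is a real number whose power with odd exponent `r + 1` equals `1`. -/
lemma det_labelShift (hr : Odd (r + 1)) (k : Fin (r + 1)) :
    LinearMap.det (labelShift κ k) = 1 := by
  have hadd : ∀ i k : Fin (r + 1),
      labelShift κ (i + k) = (labelShift κ i).comp (labelShift κ k) := fun i k =>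
    LinearMap.ext fun f => labelShift_add i k f
  have hzero : labelShift κ (0 : Fin (r + 1)) = LinearMap.id :=
    LinearMap.ext fun f => labelShift_zero f
  have hpow : ∀ n : ℕ, LinearMap.det (labelShift κ (n • k)) =
      LinearMap.det (labelShift κ k) ^ n := by
    intro n
    induction n with
    | zero => simp [hzero]
    | succ n ih => rw [succ_nsmul, hadd, LinearMap.det_comp, ih, pow_succ]
  have h1 : (r + 1) • k = 0 := by
    have := card_nsmul_eq_zero (x := k)
    simpa using this
  have := hpow (r + 1)
  rw [h1, hzero, LinearMap.det_id] at this
  exact hr.pow_injective (by simpa using this.symm)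

variable [Fintype κ] [DecidableEq κ]

/-- The vectors of the configuration `y` with the labels prescribed by `π`; the label `π j (last r)`
is not used for the class `j`. -/
def labelled (y : κ × Fin r → κ × Fin r → ℝ) (π : κ → Equiv.Perm (Fin (r + 1))) :
    κ × Fin r → κ × Fin r → ℝ :=
  fun b => labelShift κ (π b.1 b.2.castSucc) (y b)

/-- The orientation of the facet `π` of the join of chessboard complexes. -/
def orientation (π : κ → Equiv.Perm (Fin (r + 1))) : ℤ := ∏ j, (Equiv.Perm.sign (π j) : ℤ)

/-- The degree at `-z` of the map of the join of chessboard complexes given by `y`. -/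
noncomputable def chessboardDegree (y : κ × Fin r → κ × Fin r → ℝ) (z : κ × Fin r → ℝ) : ℤ :=
  ∑ π : κ → Equiv.Perm (Fin (r + 1)), orientation π * coneIndex (labelled y π) z

omit [Fintype κ] in
lemma labelled_update (y : κ × Fin r → κ × Fin r → ℝ) (c : κ × Fin r) (v : κ × Fin r → ℝ)
    (π : κ → Equiv.Perm (Fin (r + 1))) :
    labelled (update y c v) π =
      update (labelled y π) c (labelShift κ (π c.1 c.2.castSucc) v) := by
  ext1 b
  by_cases h : b = c
  · subst h; simp [labelled]
  · simp [labelled, h]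

/-- A sum over the facets, of a function invariant under cyclic shifts of the labels. -/
lemma dvd_sum_of_shift_invariant [Nonempty κ]
    (f : (κ → Equiv.Perm (Fin (r + 1))) → ℤ)
    (hf : ∀ π (k : Fin (r + 1)), f (fun j => Equiv.addLeft k * π j) = f π) :
    ((r + 1 : ℕ) : ℤ) ∣ ∑ π, f π := by
  let j₀ : κ := Classical.arbitrary κ
  rw [← Finset.sum_fiberwise univ (fun π : κ → Equiv.Perm (Fin (r + 1)) => π j₀ 0) f]
  -- Shifting by `k` carries the facets with `π j₀ 0 = 0` bijectively to those with `π j₀ 0 = k`, so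
  -- the `r + 1` fibres have equal sums.
  have : ∀ k : Fin (r + 1), ∑ π with π j₀ 0 = k, f π = ∑ π with π j₀ 0 = 0, f π := by
    intro k
    symm
    refine Finset.sum_bij' (fun π _ j => Equiv.addLeft k * π j)
      (fun π _ j => Equiv.addLeft (-k) * π j) ?_ ?_ ?_ ?_ ?_
    · intro π hπ
      simp only [mem_filter, mem_univ, true_and] at hπ ⊢
      simp [hπ]
    · intro π hπ
      simp only [mem_filter, mem_univ, true_and] at hπ ⊢
      simp [hπ]
    · intro π _
      ext1 j; ext1 x
      simp
    · intro π _
      ext1 j; ext1 x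
      simp
    · intro π _
      exact (hf π k).symm
  rw [Finset.sum_congr rfl fun k _ => this k]
  simp

omit [DecidableEq κ] in
lemma orientation_shift (hr : Odd (r + 1)) (π : κ → Equiv.Perm (Fin (r + 1))) (k : Fin (r + 1)) :
    orientation (fun j => Equiv.addLeft k * π j) = orientation π := by
  obtain ⟨h, rfl⟩ := exists_add_self_eq hr k
  have : Equiv.addLeft (h + h) = Equiv.addLeft h * Equiv.addLeft h := by
    ext x; simp
  simp [orientation, this, Int.units_mul_self]

/-- Moving one vector of the configuration changes the degree by a multiple of `r + 1`. -/
theorem chessboardDegree_update_modEq [Nonempty κ] (hr : Odd (r + 1))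
    (y : κ × Fin r → κ × Fin r → ℝ) (z : κ × Fin r → ℝ) (c : κ × Fin r) (v : κ × Fin r → ℝ)
    (hF : ∀ π, rowDet (labelled y π) ≠ 0)
    (hu : ∀ π b, rowDet (update (labelled y π) b (labelShift κ (π c.1 c.2.castSucc) v)) ≠ 0)
    (hz : ∀ π b, rowDet (update (labelled y π) b z) ≠ 0)
    (huz : ∀ π b b', b' ≠ b → rowDet (update (update (labelled y π) b
      (labelShift κ (π c.1 c.2.castSucc) v)) b' z) ≠ 0) :
    chessboardDegree y z ≡ chessboardDegree (update y c v) z [ZMOD (r + 1 : ℕ)] := by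
  rw [Int.modEq_comm, Int.modEq_iff_dvd]
  -- In the cocycle identity, the term `b = c` is the facet of the moved configuration; it is split
  -- off from the others.
  have hco : ∀ π, coneIndex (labelled y π) z - coneIndex (labelled (update y c v) π) z =
      coneIndex (labelled y π) (labelShift κ (π c.1 c.2.castSucc) v) +
      ∑ b ∈ univ.erase c,
        coneIndex (update (labelled y π) b (labelShift κ (π c.1 c.2.castSucc) v)) z := by
    intro π
    rw [← coneIndex_cocycle (hF π) (hu π) (hz π) (huz π), labelled_update,
      ← Finset.add_sum_erase univ _ (mem_univ c)]
    ring
  -- Since the vector at `b` has been replaced, its label is immaterial. Exchanging that label with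
  -- the unused one of its class fixes the family, leaves the label of `c` alone and reverses the
  -- orientation.
  have hzero : ∀ b ∈ univ.erase c, ∑ π, orientation π *
      coneIndex (update (labelled y π) b (labelShift κ (π c.1 c.2.castSucc) v)) z = 0 := by
    intro b hb
    have hbc : b ≠ c := ne_of_mem_erase hb
    let τ : Equiv.Perm (Fin (r + 1)) := Equiv.swap b.2.castSucc (Fin.last r)
    have hτ : ∀ a : Fin r, a ≠ b.2 → τ a.castSucc = a.castSucc := fun a ha =>
      Equiv.swap_apply_of_ne_of_ne (by simpa using ha) (Fin.castSucc_ne_last a)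
    have hτs : Equiv.Perm.sign τ = -1 := Equiv.Perm.sign_swap (Fin.castSucc_ne_last _)
    have hlab : ∀ (π : κ → Equiv.Perm (Fin (r + 1))) (b' : κ × Fin r), b' ≠ b →
        (update π b.1 (π b.1 * τ)) b'.1 b'.2.castSucc = π b'.1 b'.2.castSucc := by
      intro π b' hb'
      by_cases h : b'.1 = b.1
      · have : b'.2 ≠ b.2 := fun h2 => hb' (Prod.ext h h2)
        rw [h, update_self, Equiv.Perm.mul_apply, hτ _ this]
      · rw [update_of_ne h]
    refine Finset.sum_involution (fun π _ => update π b.1 (π b.1 * τ)) ?_ ?_ ?_ ?_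
    · intro π _
      have h1 : orientation (update π b.1 (π b.1 * τ)) = -orientation π := by
        rw [orientation, orientation, ← Finset.mul_prod_erase univ _ (mem_univ b.1),
          ← Finset.mul_prod_erase univ (fun j => (Equiv.Perm.sign (π j) : ℤ)) (mem_univ b.1)]
        rw [update_self, Equiv.Perm.sign_mul, hτs]
        rw [Finset.prod_congr rfl fun j hj => by rw [update_of_ne (ne_of_mem_erase hj)]]
        simp
      have h2 : update (labelled y (update π b.1 (π b.1 * τ))) b (labelShift κ (π c.1 c.2.castSucc) v) =
          update (labelled y π) b (labelShift κ (π c.1 c.2.castSucc) v) := by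
        ext1 b'
        by_cases h : b' = b
        · subst h; simp
        · rw [update_of_ne h, update_of_ne h, labelled, labelled, hlab π b' h]
      rw [h1, hlab π c hbc.symm, h2]
      ring
    · intro π _ _ h
      have := congrFun h b.1
      rw [update_self, mul_eq_left] at this
      rw [this] at hτs
      simp at hτs
    · intro π _
      exact mem_univ _
    · intro π _
      simp [mul_assoc, τ]
  -- The remaining sum no longer involves `z`, which is not fixed by the cyclic action; this is what
  -- makes the sum shift invariant.
  have : chessboardDegree y z - chessboardDegree (update y c v) z =
      ∑ π, orientation π * coneIndex (labelled y π) (labelShift κ (π c.1 c.2.castSucc) v) := by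
    rw [chessboardDegree, chessboardDegree, ← Finset.sum_sub_distrib]
    simp_rw [← mul_sub, hco, mul_add, Finset.mul_sum, Finset.sum_add_distrib]
    rw [Finset.sum_comm, Finset.sum_eq_zero hzero, add_zero]
  rw [this]
  refine dvd_sum_of_shift_invariant _ fun π k => ?_
  rw [orientation_shift hr, ← coneIndex_map (det_labelShift hr k) (labelled y π)]
  congr 2
  · ext1 b
    simp [labelled, labelShift_add]
  · simp [labelShift_add]

/-- The vectors `z`, `y` and `y'` (the latter two labelled by `π`) as one family. -/
def jointFamily (y y' : κ × Fin r → κ × Fin r → ℝ) (z : κ × Fin r → ℝ)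
    (π : κ → Equiv.Perm (Fin (r + 1))) :
    Option ((κ × Fin r) ⊕ (κ × Fin r)) → κ × Fin r → ℝ
  | none => z
  | some (Sum.inl b) => labelled y π b
  | some (Sum.inr b) => labelled y' π b

/-- The vectors of `y` are replaced by those of `y'` one at a time. Every family met on the way is a
selection without repetition from `z`, `y` and `y'`, whence the quantification over injections. -/
theorem chessboardDegree_modEq [Nonempty κ] (hr : Odd (r + 1))
    (y y' : κ × Fin r → κ × Fin r → ℝ) (z : κ × Fin r → ℝ)
    (h : ∀ π (f : κ × Fin r → Option ((κ × Fin r) ⊕ (κ × Fin r))), Injective f →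
      rowDet (fun b => jointFamily y y' z π (f b)) ≠ 0) :
    chessboardDegree y z ≡ chessboardDegree y' z [ZMOD (r + 1 : ℕ)] := by
  suffices H : ∀ S : Finset (κ × Fin r),
      chessboardDegree y z ≡ chessboardDegree (S.piecewise y' y) z [ZMOD (r + 1 : ℕ)] by
    simpa using H univ
  intro S
  induction S using Finset.induction_on with
  | empty => simp
  | insert c S hc ih =>
    refine ih.trans ?_
    rw [Finset.piecewise_insert]
    let f : κ × Fin r → Option ((κ × Fin r) ⊕ (κ × Fin r)) :=
      fun b => some (if b ∈ S then Sum.inr b else Sum.inl b)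
    have hf : Injective f := by
      intro b b' hbb
      simp only [f, Option.some.injEq] at hbb
      split_ifs at hbb <;> simpa using hbb
    have hfc : ∀ b, f b ≠ some (Sum.inr c) := by
      intro b
      simp only [f, ne_eq, Option.some.injEq]
      split_ifs with hb
      · rintro h
        exact hc (by simpa [Sum.inr.inj h] using hb)
      · simp
    have hfn : ∀ b, f b ≠ none := by simp [f]
    have hlab : ∀ π, labelled (S.piecewise y' y) π = fun b => jointFamily y y' z π (f b) := by
      intro π
      ext1 b
      by_cases hb : b ∈ S <;> simp [f, hb, jointFamily, labelled]
    have hupd : ∀ (f : κ × Fin r → Option ((κ × Fin r) ⊕ (κ × Fin r))) b o π,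
        update (fun b => jointFamily y y' z π (f b)) b (jointFamily y y' z π o) =
          fun b' => jointFamily y y' z π (update f b o b') := by
      intro f b o π
      ext1 b'
      by_cases e : b' = b
      · subst e; simp
      · simp [e]
    have hinj : ∀ (f : κ × Fin r → Option ((κ × Fin r) ⊕ (κ × Fin r))) b o, Injective f →
        (∀ b', b' ≠ b → f b' ≠ o) → Injective (update f b o) := by
      intro f b o hf ho x x' hx
      by_cases e : x = b <;> by_cases e' : x' = b
      · rw [e, e']
      · rw [e, update_self, update_of_ne e'] at hx
        exact absurd hx.symm (ho x' e')
      · rw [e', update_self, update_of_ne e] at hx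
        exact absurd hx (ho x e)
      · rw [update_of_ne e, update_of_ne e'] at hx
        exact hf hx
    have hv : ∀ π : κ → Equiv.Perm (Fin (r + 1)), labelShift κ (π c.1 c.2.castSucc) (y' c) =
        jointFamily y y' z π (some (Sum.inr c)) := fun _ => rfl
    have hzn : ∀ π, z = jointFamily y y' z π none := fun _ => rfl
    refine chessboardDegree_update_modEq hr _ z c _ (fun π => ?_) (fun π b => ?_) (fun π b => ?_)
      (fun π b b' hb => ?_)
    · rw [hlab]
      exact h π f hf
    · rw [hlab, hv, hupd]
      exact h π _ (hinj f b _ hf fun b' _ => hfc b')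
    · rw [hlab]
      nth_rw 2 [hzn π]
      rw [hupd]
      exact h π _ (hinj f b _ hf fun b' _ => hfn b')
    · rw [hlab, hv, hupd]
      nth_rw 2 [hzn π]
      rw [hupd]
      refine h π _ (hinj _ b' _ (hinj f b _ hf fun b' _ => hfc b') fun x _ => ?_)
      by_cases e : x = b
      · subst e; simp
      · rw [update_of_ne e]
        exact hfn x

end chessboard

/-! ### The degree of the standard configuration -/

section standard

variable {κ : Type*} {r : ℕ}

/-- The tensor `x ⊗ w i`, where `w i` is the class of the `i`-th basis vector in
`ℝ ^ (r + 1) / (1, …, 1)`. -/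
def labelTensor (x : κ → ℝ) (i : Fin (r + 1)) : κ × Fin r → ℝ :=
  fun b => x b.1 * ((if b.2.castSucc = i then 1 else 0) - if Fin.last r = i then 1 else 0)

lemma labelShift_labelTensor (x : κ → ℝ) (k i : Fin (r + 1)) :
    labelShift κ k (labelTensor x i) = labelTensor x (k + i) := by
  have h : ∀ j l, extendZero (labelTensor x i) j l =
      x j * ((if l = i then 1 else 0) - if Fin.last r = i then 1 else 0) := by
    intro j l
    induction l using Fin.lastCases <;> simp [labelTensor]
  ext b
  rw [labelShift_apply, h, h, labelTensor]
  simp only [sub_eq_iff_eq_add']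
  ring

variable [DecidableEq κ]

/-- The configuration in which every vector of class `j` is `e j ⊗ w 0`. -/
def standardConfig (b : κ × Fin r) : κ × Fin r → ℝ := labelTensor (Pi.single b.1 1) 0

lemma labelled_standardConfig (π : κ → Equiv.Perm (Fin (r + 1))) (b : κ × Fin r) :
    labelled standardConfig π b = labelTensor (Pi.single b.1 1) (π b.1 b.2.castSucc) := by
  rw [labelled, standardConfig, labelShift_labelTensor, add_zero]

variable [Fintype κ]

/-- Block `j` is a combination of the `w l`, weighted by the coefficient carried by label `l`, with
`0` for the unused label. Taking the representative that vanishes at the last label subtracts the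
weight of that label. -/
lemma sum_labelled_standardConfig (t : κ × Fin r → ℝ) (π : κ → Equiv.Perm (Fin (r + 1)))
    (j : κ) (a : Fin r) :
    (∑ b, t b • labelled standardConfig π b) (j, a) =
      extendZero t j ((π j).symm a.castSucc) - extendZero t j ((π j).symm (Fin.last r)) := by
  have h : ∀ l, ∑ a', t (j, a') * (if l = π j a'.castSucc then 1 else 0) =
      extendZero t j ((π j).symm l) := by
    intro l
    obtain ⟨i, rfl⟩ := (π j).surjective l
    simp only [EmbeddingLike.apply_eq_iff_eq, Equiv.symm_apply_apply]
    induction i using Fin.lastCases with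
    | last => simp [(Fin.castSucc_ne_last _).symm]
    | cast i => simp
  rw [Finset.sum_apply, Fintype.sum_prod_type, Finset.sum_eq_single j]
  · rw [← h, ← h, ← Finset.sum_sub_distrib]
    refine Finset.sum_congr rfl fun a' _ => ?_
    rw [Pi.smul_apply, labelled_standardConfig, labelTensor]
    simp [mul_sub]
  · intro j' _ hj
    refine Finset.sum_eq_zero fun a' _ => ?_
    rw [Pi.smul_apply, labelled_standardConfig, labelTensor]
    simp [hj.symm]
  · simp

/-- The standard configuration is in general position with respect to a vector all of whose blocks
are equal to a vector with distinct nonzero coordinates. -/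
lemma rowDet_standardConfig_ne_zero {ζ : Fin r → ℝ} (hζ : ∀ a, ζ a < 0) (hinj : Injective ζ)
    (π : κ → Equiv.Perm (Fin (r + 1))) (f : κ × Fin r → Option (κ × Fin r)) (hf : Injective f) :
    rowDet (fun b => (f b).elim (fun b => ζ b.2) (labelled standardConfig π)) ≠ 0 := by
  rw [rowDet_ne_zero_iff, Fintype.linearIndependent_iff]
  intro g hg
  let v : Option (κ × Fin r) → κ × Fin r → ℝ :=
    fun o => o.elim (fun b => ζ b.2) (labelled standardConfig π)
  -- Extended by zero, a relation among the selected vectors becomes one among `z` and all labelled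
  -- vectors with at least one zero coefficient. It remains to see that one zero coefficient forces
  -- all of them to vanish.
  let c : Option (κ × Fin r) → ℝ := extend f g 0
  have hcf : ∀ b, c (f b) = g b := fun b => hf.extend_apply g 0 b
  have hsum : ∑ o, c o • v o = 0 := by
    rw [← hg]
    symm
    refine Fintype.sum_of_injective f hf _ _ (fun o ho => ?_) fun b => by rw [hcf]
    simp only [c, extend_apply' g (0 : Option (κ × Fin r) → ℝ) o ho]
    simp
  obtain ⟨o₀, ho₀⟩ : ∃ o, c o = 0 := by
    have : ¬ Surjective f := fun hs => by
      have := Fintype.card_of_bijective ⟨hf, hs⟩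
      simp at this
    simp only [Surjective, not_forall] at this
    obtain ⟨o, ho⟩ := this
    exact ⟨o, extend_apply' g (0 : Option (κ × Fin r) → ℝ) o ho⟩
  suffices H : ∀ o, c o = 0 from fun b => by rw [← hcf, H]
  let t : κ × Fin r → ℝ := fun b => c (some b)
  let ξ : Fin (r + 1) → ℝ := Fin.snoc (α := fun _ => ℝ) ζ 0
  have hξc : ∀ a : Fin r, ξ a.castSucc = ζ a := fun a => by simp [ξ]
  have hξl : ξ (Fin.last r) = 0 := by simp [ξ]
  have hξ : Injective ξ := by
    intro x y hxy
    induction x using Fin.lastCases <;> induction y using Fin.lastCases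
    · rfl
    · rw [hξl, hξc] at hxy
      exact absurd hxy (hζ _).ne'
    · rw [hξl, hξc] at hxy
      exact absurd hxy (hζ _).ne
    · rw [hξc, hξc] at hxy
      rw [hinj hxy]
  have h1 : ∀ j l, c none * ξ l + extendZero t j ((π j).symm l) =
      extendZero t j ((π j).symm (Fin.last r)) := by
    intro j l
    induction l using Fin.lastCases with
    | last => simp [hξl]
    | cast a =>
      have := congrFun hsum (j, a)
      have e : ∑ b, c (some b) • v (some b) = ∑ b, t b • labelled standardConfig π b := rfl
      rw [Fintype.sum_option, Pi.add_apply, e, sum_labelled_standardConfig] at this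
      simp only [v, Option.elim_none, Pi.smul_apply, smul_eq_mul, Pi.zero_apply] at this
      rw [hξc]
      linarith
  -- Comparing with the unused label `π j (Fin.last r)` expresses every coefficient through `c
  -- none`, with a factor that is nonzero because `ξ` is injective.
  have h2 : ∀ j a, t (j, a) = c none * (ξ (π j (Fin.last r)) - ξ (π j a.castSucc)) := by
    intro j a
    have e1 := h1 j (π j (Fin.last r))
    have e2 := h1 j (π j a.castSucc)
    simp only [Equiv.symm_apply_apply, extendZero_last, extendZero_castSucc] at e1 e2
    linarith
  have hn : c none = 0 := by
    cases o₀ with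
    | none => exact ho₀
    | some b =>
      have := h2 b.1 b.2
      rw [show t (b.1, b.2) = 0 from ho₀] at this
      refine (mul_eq_zero.1 this.symm).resolve_right fun h => ?_
      exact (Fin.castSucc_ne_last b.2).symm ((π b.1).injective (hξ (sub_eq_zero.1 h)))
  rintro (_ | b)
  · exact hn
  · have := h2 b.1 b.2
    rwa [hn, zero_mul] at this

omit [Fintype κ] in
lemma labelled_standardConfig_of_fix {π : κ → Equiv.Perm (Fin (r + 1))}
    {τ : κ → Equiv.Perm (Fin r)} (h : ∀ j a, π j a.castSucc = (τ j a).castSucc)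
    (b : κ × Fin r) : labelled standardConfig π b = Pi.single (Equiv.prodCongrRight τ b) 1 := by
  ext b'
  rw [labelled_standardConfig, h, labelTensor, if_neg (Fin.castSucc_ne_last _).symm, sub_zero]
  rcases b with ⟨j, a⟩
  rcases b' with ⟨j', a'⟩
  by_cases h1 : j' = j <;> by_cases h2 : a' = τ j a <;> simp [Pi.single_apply, h1, h2]

/-- The family is the standard basis in permuted order, so its determinant is the sign of the
permutation, and the coordinates of `z` in it are values of `ζ`, all negative. -/
lemma coneIndex_standardConfig_of_fix {ζ : Fin r → ℝ} (hζ : ∀ a, ζ a < 0)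
    {π : κ → Equiv.Perm (Fin (r + 1))}
    {τ : κ → Equiv.Perm (Fin r)} (h : ∀ j a, π j a.castSucc = (τ j a).castSucc) :
    coneIndex (labelled standardConfig π) (fun b : κ × Fin r => ζ b.2) =
      ∏ j, (Equiv.Perm.sign (τ j) : ℤ) := by
  classical
  have hdet : rowDet (labelled standardConfig π) =
      ((∏ j, (Equiv.Perm.sign (τ j) : ℤ) : ℤ) : ℝ) := by
    have : Matrix.of (labelled standardConfig π) =
        Equiv.Perm.permMatrix ℝ (Equiv.prodCongrRight τ) := by
      ext b b'
      rw [Matrix.of_apply, labelled_standardConfig_of_fix h, Pi.single_apply]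
      refine Eq.trans ?_ (PEquiv.toMatrix_apply _ _ _).symm
      rw [Equiv.toPEquiv_apply]
      simp [eq_comm]
    rw [rowDet, this, Matrix.det_permutation, Equiv.Perm.sign_prodCongrRight]
    simp
  have hunit : ∏ j, (Equiv.Perm.sign (τ j) : ℤ) = 1 ∨ ∏ j, (Equiv.Perm.sign (τ j) : ℤ) = -1 := by
    have := Int.units_eq_one_or (∏ j, Equiv.Perm.sign (τ j))
    rcases this with h | h
    · left; simpa using congrArg Units.val h
    · right; simpa using congrArg Units.val h
  have hne : rowDet (labelled standardConfig π) ≠ 0 := by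
    rw [hdet]
    rcases hunit with h | h <;> simp [h]
  have hz : (fun b : κ × Fin r => ζ b.2) = ∑ b, ζ (τ b.1 b.2) • labelled standardConfig π b := by
    simp_rw [labelled_standardConfig_of_fix h]
    have := (Equiv.prodCongrRight τ).sum_comp
      (fun b : κ × Fin r => ζ b.2 • (Pi.single b 1 : κ × Fin r → ℝ))
    refine Eq.trans ?_ this.symm
    ext b
    simp [Finset.sum_apply, Pi.single_apply]
  rw [coneIndex_eq hne hz, if_pos fun b => hζ _, hdet]
  rcases hunit with h | h <;> simp [h]

/-- In class `j` the last label is used, with a coefficient `t < 0`, while `m = π j (Fin.last r)` is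
not. Coordinate `(j, m)` of `z` would then be `0 - t > 0`, whereas it is a value of `ζ`. -/
lemma coneIndex_standardConfig_of_not_fix {ζ : Fin r → ℝ} (hζ : ∀ a, ζ a < 0)
    {π : κ → Equiv.Perm (Fin (r + 1))} {j : κ} (hj : π j (Fin.last r) ≠ Fin.last r) :
    coneIndex (labelled standardConfig π) (fun b : κ × Fin r => ζ b.2) = 0 := by
  by_contra hne
  obtain ⟨-, t, ht, hz⟩ := exists_of_coneIndex_ne_zero hne
  have hm : ((π j (Fin.last r)).castPred hj).castSucc = π j (Fin.last r) := Fin.castSucc_castPred _ hj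
  have hl : (π j).symm (Fin.last r) ≠ Fin.last r := fun h =>
    hj ((Equiv.symm_apply_eq _).1 h).symm
  have hl' : (((π j).symm (Fin.last r)).castPred hl).castSucc = (π j).symm (Fin.last r) :=
    Fin.castSucc_castPred _ hl
  have := congrFun hz (j, (π j (Fin.last r)).castPred hj)
  rw [sum_labelled_standardConfig, hm, Equiv.symm_apply_apply, extendZero_last, ← hl',
    extendZero_castSucc] at this
  have h1 := hζ ((π j (Fin.last r)).castPred hj)
  have h2 := ht (j, ((π j).symm (Fin.last r)).castPred hl)
  simp only at this
  linarith

/-- Only the facets leaving the last label unused in every class contribute. For these the index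
equals the orientation, so each product is `1`, and they correspond to tuples of permutations of
`Fin r`. -/
theorem chessboardDegree_standardConfig {ζ : Fin r → ℝ} (hζ : ∀ a, ζ a < 0) :
    chessboardDegree standardConfig (fun b : κ × Fin r => ζ b.2) =
      (r.factorial : ℤ) ^ Fintype.card κ := by
  let ext (τ : Equiv.Perm (Fin r)) : Equiv.Perm (Fin (r + 1)) :=
    τ.viaFintypeEmbedding Fin.castSuccEmb
  have hext : ∀ τ a, ext τ (Fin.castSucc a) = (τ a).castSucc := fun τ a =>
    Equiv.Perm.viaFintypeEmbedding_apply_image τ Fin.castSuccEmb a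
  have hlast : ∀ τ, ext τ (Fin.last r) = Fin.last r := by
    intro τ
    refine Equiv.Perm.viaFintypeEmbedding_apply_notMem_range _ _ ?_
    rintro ⟨a, ha⟩
    exact Fin.castSucc_ne_last a ha
  have hinj : Injective fun (τ : κ → Equiv.Perm (Fin r)) j => ext (τ j) := by
    intro τ τ' h
    ext1 j; ext1 a
    have := congrArg (fun σ => σ a.castSucc) (congrFun h j)
    simpa [hext] using this
  have hsurj : ∀ π : κ → Equiv.Perm (Fin (r + 1)), (∀ j, π j (Fin.last r) = Fin.last r) →
      ∃ τ : κ → Equiv.Perm (Fin r), (fun j => ext (τ j)) = π := by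
    intro π hπ
    have hne : ∀ j (a : Fin r), π j a.castSucc ≠ Fin.last r := fun j a h =>
      Fin.castSucc_ne_last a ((π j).injective (h.trans (hπ j).symm))
    have hbij : ∀ j, Bijective fun a : Fin r => (π j a.castSucc).castPred (hne j a) := fun j =>
      Finite.injective_iff_bijective.1 fun a a' h => by simpa using h
    refine ⟨fun j => Equiv.ofBijective _ (hbij j), ?_⟩
    ext1 j; ext1 l
    induction l using Fin.lastCases with
    | last => rw [hlast, hπ]
    | cast a => rw [hext]; simp
  have hsum : ∑ _τ : κ → Equiv.Perm (Fin r), (1 : ℤ) =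
      chessboardDegree standardConfig (fun b : κ × Fin r => ζ b.2) := by
    refine Fintype.sum_of_injective _ hinj _ _ (fun π hπ => ?_) fun τ => ?_
    · have : ∃ j, π j (Fin.last r) ≠ Fin.last r := by
        by_contra! h
        exact hπ (hsurj π h)
      obtain ⟨j, hj⟩ := this
      rw [coneIndex_standardConfig_of_not_fix hζ hj, mul_zero]
    · rw [coneIndex_standardConfig_of_fix hζ (τ := τ) fun j a => hext _ _, orientation,
        ← Finset.prod_mul_distrib]
      symm
      refine Finset.prod_eq_one fun j _ => ?_
      simp [ext]
  rw [← hsum]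
  simp [Fintype.card_perm]

end standard

/-! ### General position, closedness and the existence of a balanced labelling -/

lemma exists_injective_extension {α β : Type*} [Fintype α] [Fintype β]
    (h : Fintype.card α ≤ Fintype.card β) (p : α → Prop) (g : {a // p a} → β) (hg : Injective g) :
    ∃ f : α → β, Injective f ∧ ∀ a : {a // p a}, f a = g a := by
  classical
  have hc : Fintype.card {a // ¬ p a} ≤ Fintype.card {x // ¬ x ∈ Set.range g} := by
    rw [Fintype.card_subtype_compl, Fintype.card_subtype_compl]
    have : Fintype.card {x // x ∈ Set.range g} = Fintype.card {a // p a} :=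
      (Fintype.card_congr (Equiv.ofInjective g hg)).symm
    omega
  obtain ⟨e⟩ := Function.Embedding.nonempty_of_card_le hc
  refine ⟨fun a => if h : p a then g ⟨a, h⟩ else e ⟨a, h⟩, ?_, fun a => by simp [a.2]⟩
  intro a a' haa
  simp only at haa
  split_ifs at haa with h1 h2 h2
  · simpa using hg haa
  · exact absurd ⟨_, haa⟩ (e ⟨a', h2⟩).2
  · exact absurd ⟨_, haa.symm⟩ (e ⟨a, h1⟩).2
  · simpa using e.injective (Subtype.ext haa)

section genericity

variable {κ : Type*} [Fintype κ] [DecidableEq κ] {r : ℕ}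

omit [Fintype κ] [DecidableEq κ] in
lemma continuous_labelShift [Finite κ] (i : Fin (r + 1)) : Continuous (labelShift κ i) :=
  LinearMap.continuous_of_finiteDimensional _

omit [Fintype κ] [DecidableEq κ] in
lemma continuous_labelled [Finite κ] (π : κ → Equiv.Perm (Fin (r + 1))) (b : κ × Fin r) :
    Continuous fun y : κ × Fin r → κ × Fin r → ℝ => labelled y π b :=
  (continuous_labelShift _).comp (continuous_apply b)

omit [Fintype κ] [DecidableEq κ] in
lemma continuous_jointFamily [Finite κ] (y' : κ × Fin r → κ × Fin r → ℝ) (z : κ × Fin r → ℝ)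
    (π : κ → Equiv.Perm (Fin (r + 1))) (o : Option ((κ × Fin r) ⊕ (κ × Fin r))) :
    Continuous fun y => jointFamily y y' z π o := by
  rcases o with _ | b | b
  · exact continuous_const
  · exact continuous_labelled π b
  · exact continuous_const

/-- On the line from `y` to a good configuration `η` the determinant is a polynomial, nonzero at
parameter `1`. It has finitely many roots, so good parameters accumulate at `0`. -/
lemma dense_rowDet_jointFamily_ne_zero (y' : κ × Fin r → κ × Fin r → ℝ) (z : κ × Fin r → ℝ)
    (π : κ → Equiv.Perm (Fin (r + 1)))
    (f : κ × Fin r → Option ((κ × Fin r) ⊕ (κ × Fin r)))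
    (h : ∃ η, rowDet (fun b => jointFamily η y' z π (f b)) ≠ 0) :
    Dense {y | rowDet (fun b => jointFamily y y' z π (f b)) ≠ 0} := by
  obtain ⟨η, hη⟩ := h
  intro y
  let A := fun b => jointFamily y y' z π (f b)
  let B := fun b => jointFamily η y' z π (f b)
  let P : Polynomial ℝ := Matrix.det (Matrix.of fun b i =>
    Polynomial.C (A b i) + Polynomial.X * Polynomial.C (B b i - A b i))
  have hP : ∀ ε : ℝ, P.eval ε =
      rowDet (fun b => jointFamily (y + ε • (η - y)) y' z π (f b)) := by
    intro ε
    rw [← Polynomial.coe_evalRingHom, RingHom.map_det, rowDet]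
    congr 1
    ext b i
    have : labelled (y + ε • (η - y)) π = fun b =>
        labelled y π b + ε • (labelled η π b - labelled y π b) := by
      ext1 b
      simp [labelled]
    simp only [RingHom.mapMatrix_apply, Matrix.map_apply, Matrix.of_apply,
      Polynomial.coe_evalRingHom, Polynomial.eval_add, Polynomial.eval_mul, Polynomial.eval_C,
      Polynomial.eval_X, A, B]
    rcases f b with _ | b | b
    · simp [jointFamily]
    · simp [jointFamily, this]
    · simp [jointFamily]
  have hP0 : P ≠ 0 := by
    rintro h0
    apply hη
    have := hP 1
    rw [h0] at this
    simpa using this.symm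
  have hfin : {ε : ℝ | P.eval ε = 0}.Finite := by
    refine (P.roots.toFinset.finite_toSet).subset fun ε hε => ?_
    simpa [hP0] using hε
  have hd : Dense {ε : ℝ | P.eval ε = 0}ᶜ := hfin.countable.dense_compl ℝ
  have hc : Continuous fun ε : ℝ => y + ε • (η - y) := by fun_prop
  have : (fun ε : ℝ => y + ε • (η - y)) 0 ∈ closure
      ((fun ε : ℝ => y + ε • (η - y)) '' {ε : ℝ | P.eval ε = 0}ᶜ) :=
    image_closure_subset_closure_image hc ⟨0, hd 0, rfl⟩
  simp only [zero_smul, add_zero] at this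
  refine closure_mono ?_ this
  rintro _ ⟨ε, hε, rfl⟩
  simpa [hP] using hε

/-- The selected vectors of `η` can be chosen freely. They are made equal to members of the family
of `z` and the labelled standard vectors not yet selected, which reduces the claim to
`rowDet_standardConfig_ne_zero`. -/
lemma exists_rowDet_jointFamily_ne_zero {ζ : Fin r → ℝ} (hζ : ∀ a, ζ a < 0) (hinj : Injective ζ)
    (π : κ → Equiv.Perm (Fin (r + 1)))
    (f : κ × Fin r → Option ((κ × Fin r) ⊕ (κ × Fin r))) (hf : Injective f) :
    ∃ η, rowDet (fun b => jointFamily η standardConfig (fun b => ζ b.2) π (f b)) ≠ 0 := by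
  let proj : Option ((κ × Fin r) ⊕ (κ × Fin r)) → Option (κ × Fin r) :=
    fun o => o.elim none (Sum.elim (fun _ => none) some)
  let p : κ × Fin r → Prop := fun b => ∀ c, f b ≠ some (Sum.inl c)
  obtain ⟨g, hg, hgf⟩ := exists_injective_extension (β := Option (κ × Fin r)) (by simp) p
    (fun b => proj (f b)) (by
      rintro ⟨b, hb⟩ ⟨b', hb'⟩ h
      simp only at h
      have : f b = f b' := by
        rcases e : f b with _ | c | c <;> rcases e' : f b' with _ | c' | c' <;>
          first
            | exact absurd e (hb _)
            | exact absurd e' (hb' _)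
            | simp_all [proj]
      exact Subtype.ext (hf this))
  let w : κ × Fin r → κ × Fin r → ℝ :=
    fun b => (g b).elim (fun b => ζ b.2) (labelled standardConfig π)
  have hw : rowDet w ≠ 0 := rowDet_standardConfig_ne_zero hζ hinj π g hg
  -- The inverse shift cancels the one that `labelled` applies.
  let η : κ × Fin r → κ × Fin r → ℝ := fun c =>
    labelShift κ (-(π c.1 c.2.castSucc)) (extend f w 0 (some (Sum.inl c)))
  refine ⟨η, ?_⟩
  convert hw using 2
  ext1 b
  rcases e : f b with _ | c | c
  · have := hgf ⟨b, fun c => by simp [e]⟩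
    simp [jointFamily, w, this, e, proj]
  · have : labelled η π c = extend f w 0 (f b) := by
      rw [e, labelled, ← labelShift_add, add_neg_cancel, labelShift_zero]
    rw [hf.extend_apply] at this
    exact this
  · have := hgf ⟨b, fun c => by simp [e]⟩
    simp [jointFamily, w, this, e, proj]

/-- Configurations for which `0` is a convex combination of `z` and a labelling. -/
def coneSet (κ : Type*) [Fintype κ] (r : ℕ) :
    Set ((κ × Fin r → κ × Fin r → ℝ) × (κ × Fin r → ℝ)) :=
  {q | ∃ π : κ → Equiv.Perm (Fin (r + 1)), ∃ w ∈ stdSimplex ℝ (Option (κ × Fin r)),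
    w none • q.2 + ∑ b, w (some b) • labelled q.1 π b = 0}

-- The weights range over a compact simplex and the labellings over a finite set, so eliminating
-- both preserves closedness.
omit [DecidableEq κ] in
lemma isClosed_coneSet : IsClosed (coneSet κ r) := by
  have : coneSet κ r = ⋃ π : κ → Equiv.Perm (Fin (r + 1)),
      Prod.snd '' {q : stdSimplex ℝ (Option (κ × Fin r)) ×
        ((κ × Fin r → κ × Fin r → ℝ) × (κ × Fin r → ℝ)) |
        (q.1 : Option (κ × Fin r) → ℝ) none • q.2.2 +
          ∑ b, (q.1 : Option (κ × Fin r) → ℝ) (some b) • labelled q.2.1 π b = 0} := by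
    ext q
    simp only [coneSet, Set.mem_iUnion, Set.mem_image]
    exact ⟨fun ⟨π, w, hw, h⟩ => ⟨π, (⟨w, hw⟩, q), h, rfl⟩,
      fun ⟨π, ⟨w, q'⟩, h, e⟩ => ⟨π, w.1, w.2, e ▸ h⟩⟩
  rw [this]
  refine isClosed_iUnion_of_finite fun π => ?_
  refine isClosedMap_snd_of_compactSpace _ (isClosed_eq ?_ continuous_const)
  have h1 : ∀ o, Continuous fun q : stdSimplex ℝ (Option (κ × Fin r)) ×
        ((κ × Fin r → κ × Fin r → ℝ) × (κ × Fin r → ℝ)) =>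
        (q.1 : Option (κ × Fin r) → ℝ) o := fun o =>
    (continuous_apply o).comp (continuous_subtype_val.comp continuous_fst)
  refine ((h1 none).smul (continuous_snd.comp continuous_snd)).add ?_
  exact continuous_finsetSum _ fun b _ => (h1 (some b)).smul
    ((continuous_labelled π b).comp (continuous_fst.comp continuous_snd))

/-- Some facet has `z = ∑ t b • F b` with all `t b < 0`. The weights `1` and `-t b` balance, and
dividing by their total `1 - ∑ t b` makes them convex. -/
lemma mem_coneSet_of_chessboardDegree_ne_zero {y : κ × Fin r → κ × Fin r → ℝ}
    {z : κ × Fin r → ℝ} (h : chessboardDegree y z ≠ 0) : (y, z) ∈ coneSet κ r := by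
  obtain ⟨π, -, hπ⟩ := Finset.exists_ne_zero_of_sum_ne_zero h
  obtain ⟨-, t, ht, hz⟩ := exists_of_coneIndex_ne_zero (right_ne_zero_of_mul hπ)
  have hs : ∑ b, t b ≤ 0 := Finset.sum_nonpos fun b _ => (ht b).le
  have hpos : 0 < 1 - ∑ b, t b := by linarith
  refine ⟨π, fun o => o.elim (1 - ∑ b, t b)⁻¹ (fun b => (1 - ∑ b, t b)⁻¹ * -t b), ⟨?_, ?_⟩, ?_⟩
  · rintro (_ | b)
    · exact (inv_pos.2 hpos).le
    · exact mul_nonneg (inv_pos.2 hpos).le (neg_nonneg.2 (ht b).le)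
  · rw [Fintype.sum_option]
    simp only [Option.elim_none, Option.elim_some]
    rw [← Finset.mul_sum, Finset.sum_neg_distrib]
    field_simp
    ring
  · simp only [Option.elim_none, Option.elim_some, mul_smul, neg_smul]
    rw [← Finset.smul_sum, Finset.sum_neg_distrib, ← hz, smul_neg, add_neg_cancel]

/-- Every configuration has a labelling whose convex hull together with the constant vector `-1`
contains the origin. -/
theorem exists_labelling [Nonempty κ] (hr : 2 ≤ r) (hp : (r + 1).Prime)
    (y : κ × Fin r → κ × Fin r → ℝ) : (y, fun _ => -1) ∈ coneSet κ r := by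
  have hodd : Odd (r + 1) := hp.odd_of_ne_two (by omega)
  have hgen : ∀ ζ : Fin r → ℝ, (∀ a, ζ a < 0) → Injective ζ →
      ∀ y : κ × Fin r → κ × Fin r → ℝ, (y, fun b => ζ b.2) ∈ coneSet κ r := by
    intro ζ hζ hinj
    let S : Set (κ × Fin r → κ × Fin r → ℝ) :=
      ⋂ q : (κ → Equiv.Perm (Fin (r + 1))) ×
        {f : κ × Fin r → Option ((κ × Fin r) ⊕ (κ × Fin r)) // Injective f},
        {y | rowDet (fun b => jointFamily y standardConfig (fun b => ζ b.2) q.1 (q.2.1 b)) ≠ 0}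
    have hS : Dense S := by
      refine dense_iInter_of_isOpen (fun q => ?_) fun q => ?_
      · refine isOpen_ne_fun ?_ continuous_const
        exact Continuous.matrix_det (continuous_pi fun b => continuous_jointFamily _ _ _ _)
      · exact dense_rowDet_jointFamily_ne_zero _ _ _ _
          (exists_rowDet_jointFamily_ne_zero hζ hinj _ _ q.2.2)
    have hsub : S ⊆ {y | (y, fun b => ζ b.2) ∈ coneSet κ r} := by
      intro y hy
      refine mem_coneSet_of_chessboardDegree_ne_zero fun h0 => ?_
      have := chessboardDegree_modEq hodd y standardConfig (fun b => ζ b.2)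
        fun π f hf => Set.mem_iInter.1 hy ⟨π, f, hf⟩
      rw [h0, chessboardDegree_standardConfig hζ, Int.modEq_comm, Int.modEq_zero_iff_dvd] at this
      have h1 : (r + 1) ∣ r.factorial ^ Fintype.card κ := by exact_mod_cast this
      have h2 := (Nat.Prime.dvd_factorial hp).1 (hp.dvd_of_dvd_pow h1)
      omega
    have hcl : IsClosed {y | (y, fun b => ζ b.2) ∈ coneSet κ r} :=
      isClosed_coneSet.preimage (by fun_prop)
    intro y
    exact hcl.closure_subset_iff.2 hsub (hS y)
  -- The constant vector `-1` lacks the distinct block entries needed for general position, so it is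
  -- approached by vectors that have them.
  have hlim : Filter.Tendsto
      (fun n : ℕ => (y, fun b : κ × Fin r => -1 - (b.2 : ℝ) * (1 / ((n : ℝ) + 1))))
      Filter.atTop (nhds (y, fun _ => -1)) := by
    refine tendsto_const_nhds.prodMk_nhds (tendsto_pi_nhds.2 fun b => ?_)
    have := (tendsto_one_div_add_atTop_nhds_zero_nat (𝕜 := ℝ)).const_mul (b.2 : ℝ)
    simpa using this.const_sub (-1)
  refine isClosed_coneSet.mem_of_tendsto hlim (Filter.Eventually.of_forall fun n => ?_)
  have hn : (0 : ℝ) < 1 / ((n : ℝ) + 1) := by positivity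
  refine hgen (fun a => -1 - (a : ℝ) * (1 / ((n : ℝ) + 1))) (fun a => ?_) (fun a a' h => ?_) y
  · have : 0 ≤ (a : ℝ) * (1 / ((n : ℝ) + 1)) := by positivity
    linarith
  · have : (a : ℝ) * (1 / ((n : ℝ) + 1)) = (a' : ℝ) * (1 / ((n : ℝ) + 1)) := by
      simpa using h
    have := mul_right_cancel₀ hn.ne' this
    exact Fin.ext (by exact_mod_cast this)

end genericity

/-! ### Barycentric coordinates -/

section barycentric

variable {d : ℕ}

/-- The barycentric coordinates of `p` with respect to the standard basis and the origin. -/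
def barycentric (p : EuclideanSpace ℝ (Fin d)) (j : Fin (d + 1)) : ℝ :=
  Fin.snoc (α := fun _ => ℝ) (fun i => p i) (1 - ∑ i, p i) j

@[simp] lemma barycentric_castSucc (p : EuclideanSpace ℝ (Fin d)) (i : Fin d) :
    barycentric p i.castSucc = p i := by simp [barycentric]

@[simp] lemma barycentric_last (p : EuclideanSpace ℝ (Fin d)) :
    barycentric p (Fin.last d) = 1 - ∑ i, p i := by simp [barycentric]

lemma sum_barycentric (p : EuclideanSpace ℝ (Fin d)) : ∑ j, barycentric p j = 1 := by
  simp [Fin.sum_univ_castSucc]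

lemma barycentric_toLp {q : Fin (d + 1) → ℝ} (hq : ∑ j, q j = 1) :
    barycentric (WithLp.toLp 2 fun i : Fin d => q i.castSucc) = q := by
  ext1 j
  rw [Fin.sum_univ_castSucc] at hq
  induction j using Fin.lastCases with
  | last => rw [barycentric_last]; simp only; linarith
  | cast i => simp

lemma convex_barycentric_le (j : Fin (d + 1)) (c : ℝ) :
    Convex ℝ {p : EuclideanSpace ℝ (Fin d) | barycentric p j ≤ c} := by
  intro p hp q hq a b ha hb hab
  have : barycentric (a • p + b • q) j = a * barycentric p j + b * barycentric q j := by
    induction j using Fin.lastCases with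
    | last =>
      simp only [barycentric_last, PiLp.add_apply, PiLp.smul_apply, smul_eq_mul,
        Finset.sum_add_distrib, ← Finset.mul_sum]
      linear_combination -hab
    | cast i => simp
  have h1 := mul_le_mul_of_nonneg_left (show barycentric p j ≤ c from hp) ha
  have h2 := mul_le_mul_of_nonneg_left (show barycentric q j ≤ c from hq) hb
  change barycentric (a • p + b • q) j ≤ c
  rw [this]
  have : a * c + b * c = c := by rw [← add_mul, hab, one_mul]
  linarith

end barycentric

/-! ### From balanced labellings to rainbow partitions -/

lemma ColoredTverbergProperty.mono {d r r' t : ℕ} (h : ColoredTverbergProperty d r' t)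
    (hr : r ≤ r') : ColoredTverbergProperty d r t := by
  intro C hC hd
  obtain ⟨R, ⟨hR1, hR2⟩, x, hx⟩ := h C hC hd
  exact ⟨fun i => R (Fin.castLE hr i), ⟨fun i => hR1 _, fun i j hij =>
    hR2 fun h => hij (Fin.castLE_injective hr h)⟩, x, fun i => hx _⟩

/-- If a labelling of points with barycentric coordinates `barycentric (x b)` balances the extra
vector `-1`, then the parts of the labelling other than the last one have a common point in
their convex hulls. -/
lemma exists_mem_convexHull_of_mem_coneSet {d r : ℕ}
    {x : Fin (d + 1) × Fin r → EuclideanSpace ℝ (Fin d)}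
    (h : ((fun b => labelTensor (barycentric (x b)) 0, fun _ => -1) :
      (Fin (d + 1) × Fin r → Fin (d + 1) × Fin r → ℝ) × (Fin (d + 1) × Fin r → ℝ)) ∈
        coneSet (Fin (d + 1)) r) :
    ∃ π : Fin (d + 1) → Equiv.Perm (Fin (r + 1)), ∃ p, ∀ a : Fin r,
      p ∈ convexHull ℝ (x '' {b | π b.1 b.2.castSucc = a.castSucc}) := by
  obtain ⟨π, w, ⟨hw0, hw1⟩, hw⟩ := h
  refine ⟨π, ?_⟩
  let lab : Fin (d + 1) × Fin r → Fin (r + 1) := fun b => π b.1 b.2.castSucc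
  -- The vector `-1` is the all-ones vector carrying the last label, so it adds `w none` to every
  -- coordinate of the last part's sum. Balance says that all other parts have this same sum.
  let c : Fin (d + 1) → ℝ := fun j =>
    w none + ∑ b with lab b = Fin.last r, w (some b) * barycentric (x b) j
  have hc : ∀ (a : Fin r) j,
      ∑ b with lab b = a.castSucc, w (some b) * barycentric (x b) j = c j := by
    intro a j
    have := congrFun hw (j, a)
    rw [Pi.add_apply, Finset.sum_apply] at this
    simp only [Pi.smul_apply, smul_eq_mul, labelled, labelShift_labelTensor, add_zero,
      labelTensor, Pi.zero_apply, mul_sub, Finset.sum_sub_distrib] at this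
    simp only [c, Finset.sum_filter, lab]
    simp only [mul_ite, mul_one, mul_zero, mul_neg] at this
    simp only [eq_comm (a := a.castSucc), eq_comm (a := Fin.last r)] at this
    linarith
  have hswap : ∀ l, ∑ j, ∑ b with lab b = l, w (some b) * barycentric (x b) j =
      ∑ b with lab b = l, w (some b) := by
    intro l
    rw [Finset.sum_comm]
    refine Finset.sum_congr rfl fun b _ => ?_
    rw [← Finset.mul_sum, sum_barycentric, mul_one]
  let s : ℝ := ∑ j, c j
  have hs : ∀ a : Fin r, ∑ b with lab b = a.castSucc, w (some b) = s := by
    intro a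
    rw [← hswap]
    exact Finset.sum_congr rfl fun j _ => hc a j
  have hlast0 : 0 ≤ ∑ b with lab b = Fin.last r, w (some b) :=
    Finset.sum_nonneg fun b _ => hw0 _
  -- The coordinates of a point sum to `1`, but those of the all-ones vector sum to `d + 1`.
  have hs' : s = (d + 1) * w none + ∑ b with lab b = Fin.last r, w (some b) := by
    simp only [s, c, Finset.sum_add_distrib, hswap]
    simp
  have htot : w none + (r * s + ∑ b with lab b = Fin.last r, w (some b)) = 1 := by
    rw [← hw1, Fintype.sum_option, ← Finset.sum_fiberwise univ lab fun b => w (some b),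
      Fin.sum_univ_castSucc]
    simp [hs]
  have hn := hw0 none
  have hd0 : (0 : ℝ) ≤ d * w none := by positivity
  -- If `s` were zero, all the weights would vanish, while their total is `1`.
  have hspos : 0 < s := by
    have h0 : 0 ≤ s := by rw [hs']; positivity
    refine lt_of_le_of_ne h0 fun h => ?_
    rw [← h] at hs' htot
    nlinarith
  refine ⟨WithLp.toLp 2 fun i => c i.castSucc / s, fun a => ?_⟩
  have hp : (WithLp.toLp 2 fun i => c i.castSucc / s : EuclideanSpace ℝ (Fin d)) =
      ∑ b with lab b = a.castSucc, (w (some b) / s) • x b := by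
    ext i
    simp only [WithLp.ofLp_sum, WithLp.ofLp_smul, Finset.sum_apply, Pi.smul_apply, smul_eq_mul]
    rw [← hc a i.castSucc, Finset.sum_div]
    refine Finset.sum_congr rfl fun b _ => ?_
    rw [barycentric_castSucc]
    ring
  rw [hp]
  refine (convex_convexHull ℝ _).sum_mem (fun b _ => div_nonneg (hw0 _) hspos.le) ?_ fun b hb => ?_
  · rw [← Finset.sum_div, hs, div_self hspos.ne']
  · exact subset_convexHull ℝ _ ⟨b, (Finset.mem_filter.1 hb).2, rfl⟩

theorem coloredTverbergProperty_of_prime {d r : ℕ} (hr : 2 ≤ r) (hp : (r + 1).Prime) :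
    ColoredTverbergProperty d r r := by
  intro C hC hdisj
  have hfin : ∀ j, (C j).Finite := fun j => Set.finite_of_encard_eq_coe (hC j)
  have hcard : ∀ j, Nat.card (C j) = r := fun j => by
    rw [Nat.card_coe_set_eq, Set.ncard, hC j, ENat.toNat_natCast]
  have := fun j => (hfin j).to_subtype
  let e : ∀ j, Fin r ≃ C j := fun j => (Finite.equivFinOfCardEq (hcard j)).symm
  let x : Fin (d + 1) × Fin r → EuclideanSpace ℝ (Fin d) := fun b => e b.1 b.2
  have hxC : ∀ b, x b ∈ C b.1 := fun b => (e b.1 b.2).2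
  have hclass : ∀ {b j}, x b ∈ C j → b.1 = j := by
    intro b j hb
    by_contra h
    exact (Set.disjoint_left.1 (hdisj h)) (hxC b) hb
  have hx : Injective x := by
    rintro ⟨j, a⟩ ⟨j', a'⟩ h
    obtain rfl : j = j' := hclass (b := (j, a)) (h ▸ hxC (j', a'))
    exact congrArg _ ((e j).injective (Subtype.ext h))
  obtain ⟨π, p, hp⟩ := exists_mem_convexHull_of_mem_coneSet
    (exists_labelling hr hp fun b => labelTensor (barycentric (x b)) 0)
  -- Points with the last label are discarded. The other parts are rainbow because each `π j` is
  -- injective.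
  refine ⟨fun a => x '' {b | π b.1 b.2.castSucc = a.castSucc}, ⟨fun a => ⟨?_, fun j => ?_⟩, ?_⟩,
    p, hp⟩
  · rintro _ ⟨b, -, rfl⟩
    exact Set.mem_iUnion.2 ⟨b.1, hxC b⟩
  · rw [Set.encard_le_one_iff]
    rintro _ _ ⟨⟨⟨j₁, a₁⟩, h₁, rfl⟩, hj₁⟩ ⟨⟨⟨j₂, a₂⟩, h₂, rfl⟩, hj₂⟩
    obtain rfl : j₁ = j := hclass hj₁
    obtain rfl : j₂ = j₁ := hclass hj₂
    have : a₁ = a₂ := Fin.castSucc_injective _ ((π j₂).injective (h₁.trans h₂.symm))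
    rw [this]
  · intro a a' ha
    refine Set.disjoint_left.2 ?_
    rintro _ ⟨b, hb, rfl⟩ ⟨b', hb', hbb⟩
    rw [hx hbb] at hb'
    exact ha (Fin.castSucc_injective _ (hb.symm.trans hb'))

/-! ### The lower bound and the conclusion -/

/-- With classes of fewer than `r` points clustered at the vertices of a simplex, each class is
missed by some member of any rainbow `r`-partition. -/
theorem ColoredTverbergProperty.le {d r t : ℕ} (hd : 1 ≤ d) (h : ColoredTverbergProperty d r t) :
    r ≤ t := by
  by_contra! hlt
  have hd' : (1 : ℝ) ≤ d := by exact_mod_cast hd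
  -- The points of class `k` are vertex `k` pushed towards the barycentre by distinct amounts. The
  -- `n + 2` keeps every coordinate other than the `k`-th at most `1 / (2 * (d + 1))`.
  let δ : Fin t → ℝ := fun n => 1 / ((d + 1) * (n + 2))
  have hδ : Injective δ := by
    intro n m hnm
    simp only [δ, one_div, inv_inj] at hnm
    have := mul_left_cancel₀ (by positivity) hnm
    exact Fin.ext (by exact_mod_cast add_right_cancel this)
  have hδpos : ∀ n, 0 < δ n := fun n => by simp only [δ]; positivity
  have hδle : ∀ n, (d + 1) * δ n ≤ 1 / 2 := by
    intro n
    have : (d + 1) * δ n = 1 / (n + 2) := by simp only [δ]; field_simp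
    rw [this]
    exact one_div_le_one_div_of_le two_pos (by simp)
  let q : Fin (d + 1) → Fin t → Fin (d + 1) → ℝ := fun k n j =>
    δ n + if j = k then 1 - (d + 1) * δ n else 0
  have hq : ∀ k n, ∑ j, q k n j = 1 := fun k n => by
    simp only [q, Finset.sum_add_distrib]
    simp
  let P : Fin (d + 1) → Fin t → EuclideanSpace ℝ (Fin d) := fun k n =>
    WithLp.toLp 2 fun i => q k n i.castSucc
  have hP : ∀ k n, barycentric (P k n) = q k n := fun k n => barycentric_toLp (hq k n)
  have hoff : ∀ k n j, j ≠ k → q k n j = δ n := fun k n j hj => by simp [q, hj]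
  have hinj : ∀ k, Injective (P k) := by
    intro k n m hnm
    have hqq : q k n = q k m := by rw [← hP, ← hP, hnm]
    -- For `d ≥ 1` there is a coordinate other than `k`, and it reads off `δ n`.
    have : Nontrivial (Fin (d + 1)) := Fin.nontrivial_iff_two_le.2 (by omega)
    obtain ⟨j, hj⟩ := exists_ne k
    apply hδ
    rw [← hoff k n j hj, ← hoff k m j hj, hqq]
  obtain ⟨R, ⟨hR1, hR2⟩, x, hx⟩ := h (fun k => Set.range (P k)) (fun k => by
      rw [← Set.image_univ, (hinj k).encard_image, Set.encard_univ]
      simp) (by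
      intro k k' hk
      refine Set.disjoint_left.2 ?_
      rintro _ ⟨n, rfl⟩ ⟨m, hm⟩
      have hqq : q k' m = q k n := by rw [← hP, ← hP, hm]
      have h1 := congrFun hqq k
      rw [hoff k' m k hk] at h1
      simp only [q, if_true] at h1
      have h2 := hδle m
      have h3 := hδle n
      have h4 := hδpos n
      have h5 := hδpos m
      nlinarith)
  have hmiss : ∀ j, ∃ i, Disjoint (R i) (Set.range (P j)) := by
    intro j
    by_contra! hcon
    have hne : ∀ i, ∃ n, P j n ∈ R i := fun i => by
      obtain ⟨_, h1, n, rfl⟩ := Set.not_disjoint_iff.1 (hcon i)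
      exact ⟨n, h1⟩
    choose n hn using hne
    have : Injective n := fun i i' hii => by
      by_contra hne
      exact Set.disjoint_left.1 (hR2 hne) (hn i) (hii ▸ hn i')
    have := Fintype.card_le_of_injective n this
    simp only [Fintype.card_fin] at this
    omega
  -- A member missing class `j` lies in the half-space where coordinate `j` is small, and so does
  -- its hull. This bounds every coordinate of the common point, and their sum would be at most `1 /
  -- 2` instead of `1`.
  have hle : ∀ j, barycentric x j ≤ 1 / (2 * (d + 1)) := by
    intro j
    obtain ⟨i, hi⟩ := hmiss j
    have hsub : R i ⊆ {p | barycentric p j ≤ 1 / (2 * (d + 1))} := by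
      intro p hp
      obtain ⟨k, n, rfl⟩ := Set.mem_iUnion.1 ((hR1 i).1 hp)
      have hk : j ≠ k := by
        rintro rfl
        exact Set.disjoint_left.1 hi hp ⟨n, rfl⟩
      change barycentric (P k n) j ≤ _
      rw [hP, hoff k n j hk, le_div_iff₀ (by positivity)]
      linarith [hδle n]
    exact convexHull_min hsub (convex_barycentric_le j _) (hx i)
  have h1 : ∑ j, barycentric x j ≤ ∑ _j : Fin (d + 1), 1 / (2 * ((d : ℝ) + 1)) :=
    Finset.sum_le_sum fun j _ => hle j
  rw [sum_barycentric, Finset.sum_const, Finset.card_univ, Fintype.card_fin, nsmul_eq_mul] at h1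
  have h2 : ((d + 1 : ℕ) : ℝ) * (1 / (2 * ((d : ℝ) + 1))) = 1 / 2 := by
    push_cast
    field_simp
  rw [h2] at h1
  norm_num at h1

theorem theorem1 (d r : ℕ) (hd : 1 ≤ d) (hr : 2 ≤ r) :
    (∃ t : ℕ, ColoredTverbergProperty d r t) ∧
      ((r + 1).Prime → IsLeast {t : ℕ | ColoredTverbergProperty d r t} r) := by
  refine ⟨?_, fun hp => ⟨coloredTverbergProperty_of_prime hr hp, fun t ht => ht.le hd⟩⟩
  -- For mere existence, classes of size `p - 1` give `p - 1 ≥ r` parts, of which `r` are kept.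
  obtain ⟨p, hrp, hp⟩ := Nat.exists_infinite_primes (r + 1)
  obtain ⟨r', rfl⟩ : ∃ r', p = r' + 1 := ⟨p - 1, by omega⟩
  exact ⟨r', (coloredTverbergProperty_of_prime (by omega) hp).mono (by omega)⟩
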